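/- Let $A(x_A,y_A)$, $B(x_B,y_B)$, $C(x_C,y_C)$ be the vertices of a nondegenerate triangle $T$ in the Euclidean plane, with side lengths $a=|BC|$, $b=|CA|$, $c=|AB|$ and semiperimeter $s=\frac12(a+b+c)$. Let $$V(P)=\iint_T\frac{dQ}{|PQ|}$$ be the electrostatic potential of the uniformly charged triangle $T$ (the integral is with respect to area), and let $\vec E=-\nabla V$ be its electrostatic field. Suppose that $P(x_P,y_P)$ is a point in the interior of $T$ with $\vec E(P)=\vec 0$. Then there is a $\lambda>0$ such that, with $$u=a\coth\frac{a\lambda}{2s},\qquad v=b\coth\frac{b\lambda}{2s},\qquad w=c\coth\frac{c\lambda}{2s},$$ one has $$\sqrt{(u^2-a^2)\bigl(a^2-(v-w)^2\bigr)}+\sqrt{(v^2-b^2)\bigl(b^2-(w-u)^2\bigr)}+\sqrt{(w^2-c^2)\bigl(c^2-(u-v)^2\bigr)}=\sqrt{2(a^2b^2+b^2c^2+c^2a^2)-(a^4+b^4+c^4)}$$ and the Cartesian coordinates of $P$ are $$x_P=\frac{(x_A^2+y_A^2-vw)(y_B-y_C)+(x_B^2+y_B^2-wu)(y_C-y_A)+(x_C^2+y_C^2-uv)(y_A-y_B)}{2x_A(y_B-y_C)+2x_B(y_C-y_A)+2x_C(y_A-y_B)},$$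 $$y_P=\frac{(x_A^2+y_A^2-vw)(x_B-x_C)+(x_B^2+y_B^2-wu)(x_C-x_A)+(x_C^2+y_C^2-uv)(x_A-x_B)}{2y_A(x_B-x_C)+2y_B(x_C-x_A)+2y_C(x_A-x_B)}.$$ -/

import Mathlib

noncomputable section

namespace ElectrostaticTriangle

/-- The Euclidean plane, with its distance `dist` and area measure `volume`. The Cartesian
coordinates of a point `P` are `P 0` and `P 1`. -/
abbrev Plane : Type := EuclideanSpace ℝ (Fin 2)

/-- The closed triangle with vertices `A`, `B`, `C`. -/
def triangle (A B C : Plane) : Set Plane := convexHull ℝ {A, B, C}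

/-- The electrostatic potential at `P` of the uniformly charged set `T`. -/
def potential (T : Set Plane) (P : Plane) : ℝ := ∫ Q in T, 1 / dist P Q

/-- The electrostatic field of the uniformly charged set `T`: minus the gradient of the potential.
The value is meaningful where the potential is differentiable, in particular at every interior
point of a triangle. -/
def field (T : Set Plane) (P : Plane) : Plane := -gradient (potential T) P

/-- The hyperbolic cotangent. -/
def coth (x : ℝ) : ℝ := Real.cosh x / Real.sinh x

end ElectrostaticTriangle

end

/-!
The potential of a triangle has a closed form at interior points. The segments from `P` to the
vertices cut the triangle into three subtriangles, and on the subtriangle over the side `BC` the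
map `(t, r) ↦ P + t • (B + r • (C - B) - P)` has Jacobian `t` times the doubled area of `PBC`. The
factor `t` cancels the one in `|PQ|`, so the subtriangle contributes its doubled area times the
mean of `1 / |PQ|` over the side, which is `log ((|PB| + |PC| + a) / (|PB| + |PC| - a)) / a` with
`a = |BC|` (`integral_openTriangle`, `potential_triangle`).

When the product of the area of `PBC` and this mean is differentiated in `P`, the derivative of the
area gives the mean times the side turned by a right angle, and the derivative of the mean gives a
quarter turn of the difference of the unit vectors from `P` towards `C` and `B`
(`hasFDerivAt_signedArea_mul_sidePotential`). Around the triangle the unit vectors telescope. The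
field thus vanishes exactly when the three sides, weighted by the means, add up to zero. As the
sides span the plane and their sum is zero, this forces the three means to be equal
(`sidePotential_eq_of_field_eq_zero`).

Let `k` be their common value. Solving `log ((U + a) / (U - a)) / a = k` for `U = |PB| + |PC|` gives
`U = a * coth (a * k / 2)`, so `λ = k * s` makes `u`, `v`, `w` the sums `|PB| + |PC|`,
`|PC| + |PA|`, `|PA| + |PB|`. By Heron's formula the identity between square roots says that the
areas of the three subtriangles add up to that of the triangle. Finally `vw` differs from `|PA|²` by
the symmetric expression `|PA||PB| + |PB||PC| + |PC||PA|`, which drops out of the numerators, so the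
formulas for the coordinates are the solution of the linear equations that determine `P` from its
squared distances to the vertices.
-/

namespace ElectrostaticTriangle

open MeasureTheory Set Filter Topology

/-! ### Signed areas and distances -/

/-- Twice the signed area of the triangle `XYZ`, positive for counterclockwise triangles. -/
def signedArea (X Y Z : Plane) : ℝ :=
  (Y 0 - X 0) * (Z 1 - X 1) - (Y 1 - X 1) * (Z 0 - X 0)

theorem dist_sq (X Y : Plane) : dist X Y ^ 2 = (X 0 - Y 0) ^ 2 + (X 1 - Y 1) ^ 2 := by
  rw [EuclideanSpace.dist_eq, Real.sq_sqrt (by positivity)]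
  simp [Real.dist_eq]

theorem dist_eq_sqrt (X Y : Plane) : dist X Y = √((X 0 - Y 0) ^ 2 + (X 1 - Y 1) ^ 2) := by
  rw [← dist_sq, Real.sqrt_sq dist_nonneg]

theorem dist_pos_of_signedArea_ne_zero {X Y Z : Plane} (h : signedArea X Y Z ≠ 0) :
    0 < dist X Y ∧ 0 < dist X Z ∧ 0 < dist Y Z := by
  refine ⟨dist_pos.2 ?_, dist_pos.2 ?_, dist_pos.2 ?_⟩ <;> rintro rfl <;>
    exact h (by simp only [signedArea]; ring)

theorem dist_lt_add_of_signedArea_ne_zero {P B C : Plane} (h : signedArea P B C ≠ 0) :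
    dist B C < dist P B + dist P C := by
  obtain ⟨hy, hz, ha⟩ := dist_pos_of_signedArea_ne_zero h
  have h1 := dist_sq P B
  have h2 := dist_sq P C
  have h3 := dist_sq B C
  have h4 : 0 < signedArea P B C ^ 2 := by positivity
  have key : ((B 0 - P 0) * (C 0 - P 0) + (B 1 - P 1) * (C 1 - P 1)) ^ 2
      + signedArea P B C ^ 2 = (dist P B * dist P C) ^ 2 := by
    rw [mul_pow, h1, h2]; simp only [signedArea]; ring
  have h5 := abs_lt_of_sq_lt_sq (by linarith : ((B 0 - P 0) * (C 0 - P 0) +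
    (B 1 - P 1) * (C 1 - P 1)) ^ 2 < (dist P B * dist P C) ^ 2) (by positivity)
  -- `key` is Lagrange's identity: it bounds the inner product of `B - P` and `C - P` strictly.
  refine lt_of_pow_lt_pow_left₀ 2 (by positivity) ?_
  have := (abs_lt.1 h5).1
  nlinarith

/-- The line `XY` is a null set; `Z` only witnesses that `X` and `Y` are distinct. -/
theorem ae_signedArea_ne_zero (X Y Z : Plane) (h : signedArea X Y Z ≠ 0) :
    ∀ᵐ Q : Plane, signedArea X Y Q ≠ 0 := by
  let L : AffineSubspace ℝ Plane :=
    { carrier := {Q | signedArea X Y Q = 0}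
      smul_vsub_vadd_mem' := by
        intro c p q r hp hq hr
        simp only [signedArea, mem_ofPred_eq, vsub_eq_sub, vadd_eq_add, PiLp.add_apply,
          PiLp.smul_apply, PiLp.sub_apply, smul_eq_mul] at *
        linear_combination c * hp - c * hq + hr }
  have hL : L ≠ ⊤ := by
    intro hL
    have : Z ∈ L := by rw [hL]; trivial
    exact h this
  have := Measure.addHaar_affineSubspace (volume : Measure Plane) L hL
  exact measure_eq_zero_iff_ae_notMem.1 this

/-! ### The potential of a segment -/

/-- The mean over the side `BC` of the inverse distance to `P`, in closed form. The closed form is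
the definition, so that it can be differentiated directly; it equals the mean when `P` is not on the
line `BC` (`integral_one_div_dist_segment`). -/
noncomputable def sidePotential (B C P : Plane) : ℝ :=
  Real.log ((dist P B + dist P C + dist B C) / (dist P B + dist P C - dist B C)) / dist B C

theorem sidePotential_comm (B C P : Plane) : sidePotential C B P = sidePotential B C P := by
  simp only [sidePotential, dist_comm C B, add_comm (dist P C)]

theorem integral_one_div_dist_segment {P B C : Plane} (h : signedArea P B C ≠ 0) :
    (∀ s : ℝ, 0 < dist P (B + s • (C - B))) ∧
    ∫ s in (0:ℝ)..1, 1 / dist P (B + s • (C - B)) = sidePotential B C P := by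
  obtain ⟨hy, hz, ha⟩ := dist_pos_of_signedArea_ne_zero h
  have hlt := dist_lt_add_of_signedArea_ne_zero h
  have h1 := dist_sq P B
  have h2 := dist_sq P C
  have h3 := dist_sq B C
  set a := dist B C with ha'
  have hpos : ∀ s : ℝ, 0 < dist P (B + s • (C - B)) := by
    intro s
    refine dist_pos.2 ?_
    intro hP
    have e0 : P 0 = _ := congrArg (fun X : Plane => X 0) hP
    have e1 : P 1 = _ := congrArg (fun X : Plane => X 1) hP
    simp at e0 e1
    apply h
    simp only [signedArea, e0, e1]; ring
  refine ⟨hpos, ?_⟩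
  -- `D s` is the inner product of `B + s • (C - B) - P` and `C - B`. The antiderivative used below
  -- is `log (a * ρ s + D s) / a`, where `ρ s` is the distance from `P` to `B + s • (C - B)`.
  let D : ℝ → ℝ := fun s =>
    (B 0 + s * (C 0 - B 0) - P 0) * (C 0 - B 0) + (B 1 + s * (C 1 - B 1) - P 1) * (C 1 - B 1)
  have hsq : ∀ s : ℝ, dist P (B + s • (C - B)) ^ 2 =
      (B 0 + s * (C 0 - B 0) - P 0) ^ 2 + (B 1 + s * (C 1 - B 1) - P 1) ^ 2 := by
    intro s; rw [dist_sq]; simp; ring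
  have harg : ∀ s : ℝ, 0 < a * dist P (B + s • (C - B)) + D s := by
    intro s
    have h4 : 0 < signedArea P B C ^ 2 := by positivity
    have key : D s ^ 2 + signedArea P B C ^ 2 = (a * dist P (B + s • (C - B))) ^ 2 := by
      rw [mul_pow, h3, hsq]; simp only [signedArea, D]; ring
    have := abs_lt_of_sq_lt_sq (by linarith : D s ^ 2 < (a * dist P (B + s • (C - B))) ^ 2)
      (mul_nonneg ha.le dist_nonneg)
    linarith [(abs_lt.1 this).1]
  have hdist : ∀ s : ℝ, HasDerivAt (fun s : ℝ => dist P (B + s • (C - B)))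
      (D s / dist P (B + s • (C - B))) s := by
    intro s
    have e : (fun s : ℝ => dist P (B + s • (C - B))) = fun s : ℝ =>
        √((B 0 + s * (C 0 - B 0) - P 0) ^ 2 + (B 1 + s * (C 1 - B 1) - P 1) ^ 2) := by
      funext s; rw [← hsq, Real.sqrt_sq dist_nonneg]
    have hl : ∀ x y z : ℝ, HasDerivAt (fun s : ℝ => (x + s * y - z) ^ 2)
        (2 * (x + s * y - z) * y) s := by
      intro x y z
      refine ((((hasDerivAt_id s).mul_const y).const_add x).sub_const z).pow 2 |>.congr_deriv ?_
      simp
    have := ((hl (B 0) (C 0 - B 0) (P 0)).add (hl (B 1) (C 1 - B 1) (P 1))).sqrt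
      (by simp only [Pi.add_apply]; rw [← hsq]; exact (pow_pos (hpos s) 2).ne')
    rw [e]
    refine this.congr_deriv ?_
    rw [congrFun e s]
    simp only [D]
    have h0 := (hpos s).ne'
    rw [congrFun e s] at h0
    simp only [Pi.add_apply]
    field_simp
  have hF : ∀ s : ℝ, HasDerivAt (fun s => Real.log (a * dist P (B + s • (C - B)) + D s) / a)
      (1 / dist P (B + s • (C - B))) s := by
    intro s
    have hD : HasDerivAt D (a ^ 2) s := by
      have hl : ∀ x y z : ℝ, HasDerivAt (fun s : ℝ => (x + s * y - z) * y) (y * y) s := by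
        intro x y z
        have := ((((hasDerivAt_id s).mul_const y).const_add x).sub_const z).mul_const y
        simpa using this
      refine ((hl (B 0) (C 0 - B 0) (P 0)).add (hl (B 1) (C 1 - B 1) (P 1))).congr_deriv ?_
      rw [h3]; ring
    refine ((((hdist s).const_mul a).add hD).log (harg s).ne').div_const a |>.congr_deriv ?_
    have h0 := (hpos s).ne'
    have h5 := (harg s).ne'
    simp only [Pi.add_apply]
    field_simp
    ring
  rw [intervalIntegral.integral_eq_sub_of_hasDerivAt (fun s _ => hF s)]
  · have h01 := harg 0
    have h11 := harg 1
    have eC : B + (1:ℝ) • (C - B) = C := by simp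
    have eB : B + (0:ℝ) • (C - B) = B := by simp
    rw [eC] at h11
    rw [eB] at h01
    rw [eC, eB, ← sub_div, ← Real.log_div h11.ne' h01.ne', sidePotential]
    congr 2
    have h6 : (0:ℝ) < dist P B + dist P C - dist B C := by linarith
    rw [div_eq_div_iff h01.ne' h6.ne']
    have d1 : D 1 = (dist P C ^ 2 - dist P B ^ 2 + a ^ 2) / 2 := by
      rw [h1, h2, h3]; simp only [D]; ring
    have d0 : D 0 = (dist P C ^ 2 - dist P B ^ 2 - a ^ 2) / 2 := by
      rw [h1, h2, h3]; simp only [D]; ring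
    rw [d1, d0]
    ring
  · apply Continuous.intervalIntegrable
    refine continuous_const.div (by fun_prop) fun s => (hpos s).ne'

/-! ### Differentiation with respect to the field point -/

/-- The inner product with `v` turned clockwise by a right angle. -/
noncomputable def quarterTurn (v : Plane) : Plane →L[ℝ] ℝ :=
  v 1 • EuclideanSpace.proj (0 : Fin 2) - v 0 • EuclideanSpace.proj (1 : Fin 2)

theorem quarterTurn_apply (v w : Plane) : quarterTurn v w = v 1 * w 0 - v 0 * w 1 := by
  simp [quarterTurn]

theorem hasFDerivAt_dist (B : Plane) {P : Plane} (h : 0 < dist P B) :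
    HasFDerivAt (fun P : Plane => dist P B) ((1 / dist P B) •
      ((P 0 - B 0) • EuclideanSpace.proj (0 : Fin 2) +
        (P 1 - B 1) • EuclideanSpace.proj (1 : Fin 2) : Plane →L[ℝ] ℝ)) P := by
  have e : (fun P : Plane => dist P B) = fun P : Plane =>
      √((P 0 - B 0) ^ 2 + (P 1 - B 1) ^ 2) := by
    funext P; rw [dist_eq_sqrt]
  have hp : ∀ i : Fin 2, HasFDerivAt (fun P : Plane => P i)
      (EuclideanSpace.proj i : Plane →L[ℝ] ℝ) P := fun i =>
    (EuclideanSpace.proj i : Plane →L[ℝ] ℝ).hasFDerivAt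
  have := ((((hp 0).sub_const (B 0)).pow 2).add (((hp 1).sub_const (B 1)).pow 2)).sqrt
    (by simp only [Pi.add_apply]; rw [← dist_sq]; positivity)
  rw [e]
  refine this.congr_fderiv ?_
  simp only [Pi.add_apply]
  rw [← dist_eq_sqrt]
  ext w
  simp
  field_simp

theorem hasFDerivAt_signedArea (B C P : Plane) :
    HasFDerivAt (fun P : Plane => signedArea P B C) (quarterTurn (B - C)) P := by
  have hp : ∀ i : Fin 2, HasFDerivAt (fun P : Plane => P i)
      (EuclideanSpace.proj i : Plane →L[ℝ] ℝ) P := fun i =>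
    (EuclideanSpace.proj i : Plane →L[ℝ] ℝ).hasFDerivAt
  have := (((hp 0).const_sub (B 0)).mul ((hp 1).const_sub (C 1))).sub
    (((hp 1).const_sub (B 1)).mul ((hp 0).const_sub (C 0)))
  refine this.congr_fderiv ?_
  ext w
  simp [quarterTurn_apply]
  ring

/-- The second summand is a difference of one term for `C` and one for `B`, so it cancels when the
three sides of a triangle are added up. -/
theorem hasFDerivAt_signedArea_mul_sidePotential {P B C : Plane} (h : signedArea P B C ≠ 0) :
    HasFDerivAt (fun P : Plane => signedArea P B C * sidePotential B C P)
      (sidePotential B C P • quarterTurn (B - C) +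
        (quarterTurn ((1 / dist P C) • (C - P)) - quarterTurn ((1 / dist P B) • (B - P)))) P := by
  obtain ⟨hy, hz, ha⟩ := dist_pos_of_signedArea_ne_zero h
  have hlt := dist_lt_add_of_signedArea_ne_zero h
  have h1 := dist_sq P B
  have h2 := dist_sq P C
  have h3 := dist_sq B C
  have hs := (hasFDerivAt_dist B hy).add (hasFDerivAt_dist C hz)
  have hm : 0 < dist P B + dist P C - dist B C := by linarith
  have hp : 0 < dist P B + dist P C + dist B C := by linarith
  have hlog := (((hs.add_const (dist B C)).log hp.ne').sub
    ((hs.sub_const (dist B C)).log hm.ne')).mul_const (1 / dist B C)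
  have hmu : HasFDerivAt (sidePotential B C) _ P := hlog.congr_of_eventuallyEq (by
    have hc : Continuous fun P : Plane => dist P B + dist P C := by fun_prop
    filter_upwards [hc.continuousAt.eventually_const_lt hlt] with Q hQ
    have : 0 < dist B C := ha
    rw [sidePotential, Real.log_div (by linarith) (by linarith)]
    simp [div_eq_mul_inv])
  refine ((hasFDerivAt_signedArea B C P).mul hmu).congr_fderiv ?_
  -- With `θ` the angle at `P`, the area over `N` is `sin θ / (1 + cos θ)`, and `hmain` says that
  -- this multiple of `e_B + e_C` is `e_C - e_B` turned, for the unit vectors `e_B`, `e_C` from `P`.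
  set N : ℝ := dist P B * dist P C +
    ((B 0 - P 0) * (C 0 - P 0) + (B 1 - P 1) * (C 1 - P 1)) with hN
  have hprod : (dist P B + dist P C + dist B C) * (dist P B + dist P C - dist B C) = 2 * N := by
    rw [hN]; linear_combination h1 + h2 - h3
  have hN0 : N ≠ 0 := by
    have := mul_pos hp hm
    exact (by linarith : 0 < N).ne'
  have hdiff : (dist B C)⁻¹ * ((dist P B + dist P C + dist B C)⁻¹ -
      (dist P B + dist P C - dist B C)⁻¹) = -N⁻¹ := by
    rw [inv_sub_inv hp.ne' hm.ne', hprod]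
    field_simp
    ring
  ext w
  have hmain : N⁻¹ * signedArea P B C *
      ((dist P B)⁻¹ * ((B 0 - P 0) * w 0 + (B 1 - P 1) * w 1) +
        (dist P C)⁻¹ * ((C 0 - P 0) * w 0 + (C 1 - P 1) * w 1)) =
      (dist P C)⁻¹ * ((C 1 - P 1) * w 0 - (C 0 - P 0) * w 1) -
        (dist P B)⁻¹ * ((B 1 - P 1) * w 0 - (B 0 - P 0) * w 1) := by
    field_simp
    rw [hN]
    simp only [signedArea]
    linear_combination (-(dist P C * ((C 1 - P 1) * w 0 - (C 0 - P 0) * w 1))) * h1 +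
      (dist P B * ((B 1 - P 1) * w 0 - (B 0 - P 0) * w 1)) * h2
  simp only [Pi.add_apply, add_apply, sub_apply, smul_apply, PiLp.proj_apply, smul_eq_mul,
    quarterTurn_apply, PiLp.smul_apply, PiLp.sub_apply, one_div]
  linear_combination signedArea P B C *
    ((dist P B)⁻¹ * ((P 0 - B 0) * w 0 + (P 1 - B 1) * w 1) +
        (dist P C)⁻¹ * ((P 0 - C 0) * w 0 + (P 1 - C 1) * w 1)) * hdiff + hmain

/-! ### The potential at a vertex of a triangle -/

/-- The points whose barycentric coordinates with respect to `X`, `Y`, `Z` are positive, provided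
that `XYZ` is counterclockwise. -/
def openTriangle (X Y Z : Plane) : Set Plane :=
  {Q | 0 < signedArea Q Y Z ∧ 0 < signedArea X Q Z ∧ 0 < signedArea X Y Q}

theorem isOpen_openTriangle (X Y Z : Plane) : IsOpen (openTriangle X Y Z) := by
  unfold openTriangle signedArea
  exact (isOpen_lt (by fun_prop) (by fun_prop)).and
    ((isOpen_lt (by fun_prop) (by fun_prop)).and (isOpen_lt (by fun_prop) (by fun_prop)))

/-- The potential of a counterclockwise triangle at its vertex `P`. -/
theorem integral_openTriangle {P B C : Plane} (h : 0 < signedArea P B C) :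
    IntegrableOn (fun Q => 1 / dist P Q) (openTriangle P B C) ∧
    ∫ Q in openTriangle P B C, 1 / dist P Q = signedArea P B C * sidePotential B C P := by
  obtain ⟨hpos, hint⟩ := integral_one_div_dist_segment h.ne'
  let e : ℝ × ℝ ≃ᵐ Plane :=
    (MeasurableEquiv.finTwoArrow (α := ℝ)).symm.trans (MeasurableEquiv.toLp 2 (Fin 2 → ℝ))
  have he0 : ∀ q : ℝ × ℝ, e q 0 = q.1 := fun q => rfl
  have he1 : ∀ q : ℝ × ℝ, e q 1 = q.2 := fun q => rfl
  have hmp : MeasurePreserving e :=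
    (volume_preserving_finTwoArrow ℝ).symm.trans
      (EuclideanSpace.volume_preserving_symm_measurableEquiv_toLp (Fin 2)).symm
  -- `φ (t, r)` is the point at fraction `t` of the way from `P` to `B + r • (C - B)`.
  let φ : ℝ × ℝ → ℝ × ℝ := fun q =>
    (P 0 + q.1 * (B 0 + q.2 * (C 0 - B 0) - P 0), P 1 + q.1 * (B 1 + q.2 * (C 1 - B 1) - P 1))
  let φ' : ℝ × ℝ → (ℝ × ℝ →L[ℝ] ℝ × ℝ) := fun q =>
    LinearMap.toContinuousLinearMap (Matrix.toLin (Module.Basis.finTwoProd ℝ)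
      (Module.Basis.finTwoProd ℝ)
      !![B 0 + q.2 * (C 0 - B 0) - P 0, q.1 * (C 0 - B 0);
         B 1 + q.2 * (C 1 - B 1) - P 1, q.1 * (C 1 - B 1)])
  have hφ' : ∀ q, HasFDerivAt φ (φ' q) q := by
    intro q
    have h1 : ∀ x y z : ℝ, HasFDerivAt (fun q : ℝ × ℝ => z + q.1 * (x + q.2 * y - z)) _ q :=
      fun x y z => ((hasFDerivAt_fst (𝕜 := ℝ) (E := ℝ) (F := ℝ) (p := q)).mul
        ((((hasFDerivAt_snd (𝕜 := ℝ) (E := ℝ) (F := ℝ) (p := q)).mul_const y).const_add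
          x).sub_const z)).const_add z
    refine ((h1 (B 0) (C 0 - B 0) (P 0)).prodMk (h1 (B 1) (C 1 - B 1) (P 1))).congr_fderiv ?_
    ext <;> simp [φ', Matrix.toLin_finTwoProd_apply]
  have hdet : ∀ q, (φ' q).det = q.1 * signedArea P B C := by
    intro q
    simp only [φ', LinearMap.det_toContinuousLinearMap, LinearMap.det_toLin, Matrix.det_fin_two_of,
      signedArea]
    ring
  let S : Set (ℝ × ℝ) := Ioo 0 1 ×ˢ Ioo 0 1
  have hS : MeasurableSet S := measurableSet_Ioo.prod measurableSet_Ioo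
  have hA1 : ∀ q, signedArea (e (φ q)) B C = (1 - q.1) * signedArea P B C := by
    intro q; simp only [signedArea, he0, he1, φ]; ring
  have hA2 : ∀ q, signedArea P (e (φ q)) C = q.1 * (1 - q.2) * signedArea P B C := by
    intro q; simp only [signedArea, he0, he1, φ]; ring
  have hA3 : ∀ q, signedArea P B (e (φ q)) = q.1 * q.2 * signedArea P B C := by
    intro q; simp only [signedArea, he0, he1, φ]; ring
  have hinj : InjOn φ S := by
    intro p hp q hq hpq
    have e1 := hA1 p
    have e3 := hA3 p
    rw [hpq, hA1] at e1
    rw [hpq, hA3] at e3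
    have t1 : p.1 = q.1 := by
      have := mul_right_cancel₀ h.ne' e1
      linarith
    have t2 := mul_right_cancel₀ h.ne' e3
    rw [t1] at t2
    exact Prod.ext t1 (mul_left_cancel₀ hq.1.1.ne' t2).symm
  have himage : φ '' S = e ⁻¹' openTriangle P B C := by
    ext q
    constructor
    · rintro ⟨p, ⟨⟨hp1, hp2⟩, hp3, hp4⟩, rfl⟩
      have a1 : 0 < 1 - p.1 := by linarith
      have a2 : 0 < 1 - p.2 := by linarith
      refine ⟨?_, ?_, ?_⟩
      · rw [hA1]; positivity
      · rw [hA2]; positivity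
      · rw [hA3]; positivity
    · rintro ⟨h1, h2, h3⟩
      have hsum : signedArea (e q) B C + signedArea P (e q) C + signedArea P B (e q) =
        signedArea P B C := by simp only [signedArea]; ring
      set β := signedArea P (e q) C with hβ
      set γ := signedArea P B (e q) with hγ
      have hβγ : 0 < β + γ := by positivity
      refine ⟨((β + γ) / signedArea P B C, γ / (β + γ)),
        ⟨⟨by positivity, ?_⟩, by positivity, ?_⟩, ?_⟩
      · rw [div_lt_one h]; linarith
      · rw [div_lt_one hβγ]; linarith
      · have hd := h.ne'
        have hd' := hβγ.ne'
        refine Prod.ext ?_ ?_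
        · simp only [φ]
          field_simp
          rw [hβ, hγ]
          simp only [signedArea, he0, he1]; ring
        · simp only [φ]
          field_simp
          rw [hβ, hγ]
          simp only [signedArea, he0, he1]; ring
  have hkernel : ∀ q ∈ S, |(φ' q).det| • (1 / dist P (e (φ q))) =
      signedArea P B C * (1 / dist P (B + q.2 • (C - B))) := by
    intro q hq
    have hq1 : 0 < q.1 := hq.1.1
    have hd : dist P (e (φ q)) = q.1 * dist P (B + q.2 • (C - B)) := by
      rw [← abs_of_pos hq1, ← Real.norm_eq_abs, dist_eq_norm, dist_eq_norm, ← norm_smul]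
      congr 1
      ext i
      fin_cases i
      · simp [he0, φ]; ring
      · simp [he1, φ]; ring
    rw [hdet, abs_of_pos (mul_pos hq1 h), hd, smul_eq_mul]
    have := (hpos q.2).ne'
    field_simp
  have hcont : Continuous fun s : ℝ => 1 / dist P (B + s • (C - B)) :=
    continuous_const.div (by fun_prop) fun s => (hpos s).ne'
  have hemb := e.measurableEmbedding
  constructor
  · rw [← hmp.integrableOn_comp_preimage hemb, ← himage,
      integrableOn_image_iff_integrableOn_abs_det_fderiv_smul volume hS
        (fun q _ => (hφ' q).hasFDerivWithinAt) hinj]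
    refine IntegrableOn.congr_fun ?_ (fun q hq => (hkernel q hq).symm) hS
    have hc : Continuous fun q : ℝ × ℝ => signedArea P B C * (1 / dist P (B + q.2 • (C - B))) :=
      continuous_const.mul (hcont.comp continuous_snd)
    exact (hc.continuousOn.integrableOn_compact
      (isCompact_Icc.prod isCompact_Icc)).mono_set (prod_mono Ioo_subset_Icc_self Ioo_subset_Icc_self)
  · rw [← hmp.setIntegral_preimage_emb hemb, ← himage,
      integral_image_eq_integral_abs_det_fderiv_smul volume hS
        (fun q _ => (hφ' q).hasFDerivWithinAt) hinj, setIntegral_congr_fun hS hkernel]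
    have := setIntegral_prod_mul (μ := volume) (ν := volume) (fun _ : ℝ => signedArea P B C)
      (fun s : ℝ => 1 / dist P (B + s • (C - B))) (Ioo 0 1) (Ioo 0 1)
    rw [Measure.volume_eq_prod, this, ← hint, intervalIntegral.integral_of_le zero_le_one,
      integral_Ioc_eq_integral_Ioo]
    simp

/-! ### The triangle in barycentric coordinates -/

theorem signedArea_rotate (X Y Z : Plane) : signedArea Y Z X = signedArea X Y Z := by
  simp only [signedArea]; ring

theorem signedArea_swap (X Y Z : Plane) : signedArea X Z Y = -signedArea X Y Z := by
  simp only [signedArea]; ring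

theorem openTriangle_rotate (X Y Z : Plane) : openTriangle Y Z X = openTriangle X Y Z := by
  ext Q
  simp only [openTriangle, mem_ofPred_eq]
  rw [signedArea_rotate X Q Z, signedArea_rotate X Y Q, signedArea_rotate Q Y Z]
  tauto

theorem signedArea_ne_zero_of_affineIndependent {A B C : Plane}
    (h : AffineIndependent ℝ ![A, B, C]) : signedArea A B C ≠ 0 := by
  intro hD
  have key : ∀ x y z : ℝ, x + y + z = 0 → x • A + y • B + z • C = 0 → x = 0 ∧ y = 0 ∧ z = 0 := by
    intro x y z h0 h1
    have := (affineIndependent_iff.1 h) Finset.univ ![x, y, z]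
      (by simpa [Fin.sum_univ_three] using h0) (by simpa [Fin.sum_univ_three] using h1)
    exact ⟨this 0 (by simp), this 1 (by simp), this 2 (by simp)⟩
  simp only [signedArea] at hD
  have k1 := key (-((C 1 - A 1) - (B 1 - A 1))) (C 1 - A 1) (-(B 1 - A 1)) (by ring) (by
    ext i; fin_cases i
    · simp; linear_combination hD
    · simp; ring)
  have k0 := key (-((C 0 - A 0) - (B 0 - A 0))) (C 0 - A 0) (-(B 0 - A 0)) (by ring) (by
    ext i; fin_cases i
    · simp; ring
    · simp; linear_combination -hD)
  have hBA : B = A := by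
    ext i; fin_cases i
    · simp; linarith [k0.2.2]
    · simp; linarith [k1.2.2]
  have := key (-1) 1 0 (by norm_num) (by rw [hBA]; simp)
  norm_num at this

theorem mem_triangle_iff {A B C : Plane} (h : 0 < signedArea A B C) (Q : Plane) :
    Q ∈ triangle A B C ↔
      0 ≤ signedArea Q B C ∧ 0 ≤ signedArea A Q C ∧ 0 ≤ signedArea A B Q := by
  constructor
  · have hconv : Convex ℝ {Q : Plane |
        0 ≤ signedArea Q B C ∧ 0 ≤ signedArea A Q C ∧ 0 ≤ signedArea A B Q} := by
      intro X hX Y hY x y hx hy hxy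
      have hy' : y = 1 - x := by linarith
      obtain ⟨a1, a2, a3⟩ := hX
      obtain ⟨b1, b2, b3⟩ := hY
      have e1 : signedArea (x • X + y • Y) B C = x * signedArea X B C + y * signedArea Y B C := by
        simp only [signedArea, PiLp.add_apply, PiLp.smul_apply, smul_eq_mul, hy']; ring
      have e2 : signedArea A (x • X + y • Y) C = x * signedArea A X C + y * signedArea A Y C := by
        simp only [signedArea, PiLp.add_apply, PiLp.smul_apply, smul_eq_mul, hy']; ring
      have e3 : signedArea A B (x • X + y • Y) = x * signedArea A B X + y * signedArea A B Y := by
        simp only [signedArea, PiLp.add_apply, PiLp.smul_apply, smul_eq_mul, hy']; ring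
      refine ⟨?_, ?_, ?_⟩
      · rw [e1]; positivity
      · rw [e2]; positivity
      · rw [e3]; positivity
    refine fun hQ => convexHull_min ?_ hconv hQ
    have z1 : ∀ X Y : Plane, signedArea X X Y = 0 := fun X Y => by simp only [signedArea]; ring
    have z2 : ∀ X Y : Plane, signedArea X Y X = 0 := fun X Y => by simp only [signedArea]; ring
    have z3 : ∀ X Y : Plane, signedArea X Y Y = 0 := fun X Y => by simp only [signedArea]; ring
    rintro X (rfl | rfl | rfl)
    · exact ⟨h.le, (z1 _ _).ge, (z2 _ _).ge⟩
    · exact ⟨(z1 _ _).ge, h.le, (z3 _ _).ge⟩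
    · exact ⟨(z2 _ _).ge, (z3 _ _).ge, h.le⟩
  · rintro ⟨h1, h2, h3⟩
    have hsum : signedArea Q B C + signedArea A Q C + signedArea A B Q = signedArea A B C := by
      simp only [signedArea]; ring
    have hmem := (convex_convexHull ℝ {A, B, C}).sum_mem (t := Finset.univ)
      (w := ![signedArea Q B C / signedArea A B C, signedArea A Q C / signedArea A B C,
        signedArea A B Q / signedArea A B C]) (z := ![A, B, C])
      (by intro i _; fin_cases i <;> simp <;> positivity)
      (by simp [Fin.sum_univ_three, ← add_div, hsum, h.ne'])
      (by intro i _; apply subset_convexHull; fin_cases i <;> simp)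
    have hd := h.ne'
    rw [Fin.sum_univ_three] at hmem
    refine mem_of_eq_of_mem ?_ hmem
    ext i
    fin_cases i
    · simp; field_simp; simp only [signedArea]; ring
    · simp; field_simp; simp only [signedArea]; ring

/-- Moving a point of the interior slightly away from a vertex keeps it in the triangle, whereas the
barycentric coordinate of that vertex would become negative if it were zero. -/
theorem interior_triangle_subset {A B C : Plane} (h : 0 < signedArea A B C) :
    interior (triangle A B C) ⊆ openTriangle A B C := by
  intro P hP
  have hnhds := mem_interior_iff_mem_nhds.1 hP
  have key : ∀ X : Plane, ∃ r : ℝ, 0 < r ∧ P + r • (P - X) ∈ triangle A B C := by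
    intro X
    have hc : Tendsto (fun r : ℝ => P + r • (P - X)) (𝓝[>] 0) (𝓝 P) := by
      have : Continuous fun r : ℝ => P + r • (P - X) := by fun_prop
      have := this.tendsto 0
      simp only [zero_smul, add_zero] at this
      exact this.mono_left nhdsWithin_le_nhds
    obtain ⟨r, hr, hr0⟩ := ((hc.eventually hnhds).and self_mem_nhdsWithin).exists
    exact ⟨r, hr0, hr⟩
  obtain ⟨r, hr, hrA⟩ := key A
  obtain ⟨s, hs, hsB⟩ := key B
  obtain ⟨t, ht, htC⟩ := key C
  have e1 := ((mem_triangle_iff h _).1 hrA).1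
  have e2 := ((mem_triangle_iff h _).1 hsB).2.1
  have e3 := ((mem_triangle_iff h _).1 htC).2.2
  have f1 : signedArea (P + r • (P - A)) B C =
      (1 + r) * signedArea P B C - r * signedArea A B C := by
    simp [signedArea]; ring
  have f2 : signedArea A (P + s • (P - B)) C =
      (1 + s) * signedArea A P C - s * signedArea A B C := by
    simp [signedArea]; ring
  have f3 : signedArea A B (P + t • (P - C)) =
      (1 + t) * signedArea A B P - t * signedArea A B C := by
    simp [signedArea]; ring
  rw [f1] at e1
  rw [f2] at e2
  rw [f3] at e3
  refine ⟨?_, ?_, ?_⟩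
  · exact pos_of_mul_pos_right (by linarith [mul_pos hr h] : 0 < (1 + r) * _) (by positivity)
  · exact pos_of_mul_pos_right (by linarith [mul_pos hs h] : 0 < (1 + s) * _) (by positivity)
  · exact pos_of_mul_pos_right (by linarith [mul_pos ht h] : 0 < (1 + t) * _) (by positivity)

theorem openTriangle_subset {A B C P : Plane} (hP : P ∈ openTriangle A B C) :
    openTriangle P B C ⊆ openTriangle A B C := by
  rintro Q ⟨h1, h2, h3⟩
  obtain ⟨p1, p2, p3⟩ := hP
  have hD : signedArea P B C + signedArea A P C + signedArea A B P = signedArea A B C := by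
      simp only [signedArea]; ring
  have hD' : 0 < signedArea A B C := by linarith
  refine ⟨h1, ?_, ?_⟩
  · have e : signedArea P B C * signedArea A Q C =
        signedArea Q B C * signedArea A P C + signedArea P Q C * signedArea A B C := by
      simp only [signedArea]; ring
    exact pos_of_mul_pos_right (by rw [e]; positivity : 0 < signedArea P B C * _) p1.le
  · have e : signedArea P B C * signedArea A B Q =
        signedArea Q B C * signedArea A B P + signedArea P B Q * signedArea A B C := by
      simp only [signedArea]; ring
    exact pos_of_mul_pos_right (by rw [e]; positivity : 0 < signedArea P B C * _) p1.le

theorem openTriangle_subset_triangle {A B C : Plane} (h : 0 < signedArea A B C) :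
    openTriangle A B C ⊆ triangle A B C := fun Q hQ =>
  (mem_triangle_iff h Q).2 ⟨hQ.1.le, hQ.2.1.le, hQ.2.2.le⟩

/-! ### Potential and field of a triangle -/

theorem potential_triangle {A B C P : Plane} (h : 0 < signedArea A B C)
    (hP : P ∈ openTriangle A B C) :
    potential (triangle A B C) P =
      signedArea P B C * sidePotential B C P + signedArea P C A * sidePotential C A P +
        signedArea P A B * sidePotential A B P := by
  have hPB : P ∈ openTriangle B C A := by rwa [openTriangle_rotate]
  have hPC : P ∈ openTriangle C A B := by rwa [openTriangle_rotate, openTriangle_rotate]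
  have hA : 0 < signedArea P B C := hP.1
  have hB : 0 < signedArea P C A := hPB.1
  have hC : 0 < signedArea P A B := hPC.1
  obtain ⟨iA, eA⟩ := integral_openTriangle hA
  obtain ⟨iB, eB⟩ := integral_openTriangle hB
  obtain ⟨iC, eC⟩ := integral_openTriangle hC
  have hsubA := openTriangle_subset hP
  have hsubB : openTriangle P C A ⊆ openTriangle A B C := by
    rw [← openTriangle_rotate A]; exact openTriangle_subset hPB
  have hsubC : openTriangle P A B ⊆ openTriangle A B C := by
    rw [← openTriangle_rotate A, ← openTriangle_rotate B]; exact openTriangle_subset hPC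
  have hset : triangle A B C =ᵐ[volume]
      ((openTriangle P B C ∪ openTriangle P C A) ∪ openTriangle P A B : Set Plane) := by
    have nA := ae_signedArea_ne_zero P A B hC.ne'
    have nB := ae_signedArea_ne_zero P B C hA.ne'
    have nC := ae_signedArea_ne_zero P C A hB.ne'
    have nBC := ae_signedArea_ne_zero B C A (by rw [signedArea_rotate]; exact h.ne')
    have nCA := ae_signedArea_ne_zero C A B (by
      rw [signedArea_rotate, signedArea_rotate]; exact h.ne')
    have nAB := ae_signedArea_ne_zero A B C h.ne'
    -- Off the lines through two of the four points, exactly one subtriangle contains a given point: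
    -- by `rel` the signs of its areas with `PA`, `PB`, `PC` are mixed, so going round the triangle
    -- there is exactly one place where the sign drops from positive to negative.
    filter_upwards [nA, nB, nC, nBC, nCA, nAB] with Q nA nB nC nBC nCA nAB
    refine propext ⟨fun hQ => ?_, fun hQ => ?_⟩
    · obtain ⟨q1, q2, q3⟩ := (mem_triangle_iff h Q).1 hQ
      rw [← signedArea_rotate A Q C] at q2
      rw [signedArea_rotate Q] at q3
      rw [signedArea_rotate Q] at nBC nCA
      rw [signedArea_rotate Q] at nAB
      have rel : signedArea P B C * signedArea P A Q + signedArea P C A * signedArea P B Q +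
          signedArea P A B * signedArea P C Q = 0 := by
        simp only [signedArea]; ring
      have p1 := lt_of_le_of_ne q1 nBC.symm
      have p2 := lt_of_le_of_ne q2 nCA.symm
      have p3 := lt_of_le_of_ne q3 nAB.symm
      change Q ∈ (openTriangle P B C ∪ openTriangle P C A) ∪ openTriangle P A B
      simp only [openTriangle, mem_union, mem_ofPred_eq, p1, p2, p3, true_and,
        signedArea_swap P A Q, signedArea_swap P B Q, signedArea_swap P C Q, neg_pos]
      rcases lt_or_gt_of_ne nA with sA | sA <;> rcases lt_or_gt_of_ne nB with sB | sB <;>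
        rcases lt_or_gt_of_ne nC with sC | sC <;> simp only [sA, sB, sC, and_self, true_or, or_true]
      · exfalso; nlinarith
      · exfalso; nlinarith [mul_pos hA sA, mul_pos hB sB, mul_pos hC sC]
    · apply openTriangle_subset_triangle h
      rcases hQ with (hQ | hQ) | hQ
      exacts [hsubA hQ, hsubB hQ, hsubC hQ]
  have disj : ∀ X Y Z : Plane, Disjoint (openTriangle P X Y) (openTriangle P Y Z) := by
    intro X Y Z
    rw [Set.disjoint_left]
    rintro Q ⟨_, h1, _⟩ ⟨_, _, h2⟩
    rw [signedArea_swap] at h1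
    linarith
  have mB := (isOpen_openTriangle P C A).measurableSet
  have mC := (isOpen_openTriangle P A B).measurableSet
  rw [potential, setIntegral_congr_set hset,
    setIntegral_union (disjoint_union_left.2 ⟨(disj A B C).symm, disj C A B⟩) mC (iA.union iB) iC,
    setIntegral_union (disj B C A) mB iA iB, eA, eB, eC]

/-- The differentiability of the potential at `P`, without which the gradient would be zero by
convention, comes from the closed form. -/
theorem sidePotential_eq_of_field_eq_zero {A B C P : Plane} (h : 0 < signedArea A B C)
    (hP : P ∈ openTriangle A B C) (hE : field (triangle A B C) P = 0) :
    sidePotential B C P = sidePotential C A P ∧ sidePotential C A P = sidePotential A B P := by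
  have hPB : P ∈ openTriangle B C A := by rwa [openTriangle_rotate]
  have hPC : P ∈ openTriangle C A B := by rwa [openTriangle_rotate, openTriangle_rotate]
  have hd := ((hasFDerivAt_signedArea_mul_sidePotential hP.1.ne').add
    (hasFDerivAt_signedArea_mul_sidePotential hPB.1.ne')).add
    (hasFDerivAt_signedArea_mul_sidePotential hPC.1.ne')
  have hV := hd.congr_of_eventuallyEq (f₁ := potential (triangle A B C)) (by
    filter_upwards [(isOpen_openTriangle A B C).mem_nhds hP] with Q hQ
    exact potential_triangle h hQ)
  rw [field, neg_eq_zero, gradient, LinearIsometryEquiv.map_eq_zero_iff, hV.fderiv] at hE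
  have h0 := DFunLike.congr_fun hE !₂[1, 0]
  have h1 := DFunLike.congr_fun hE !₂[0, 1]
  simp [quarterTurn_apply] at h0 h1
  have hD := h.ne'
  set k₁ := sidePotential B C P
  set k₂ := sidePotential C A P
  set k₃ := sidePotential A B P
  have e0 : k₁ * (B 0 - C 0) + k₂ * (C 0 - A 0) + k₃ * (A 0 - B 0) = 0 := by
    linear_combination -h1
  have e1 : k₁ * (B 1 - C 1) + k₂ * (C 1 - A 1) + k₃ * (A 1 - B 1) = 0 := by
    linear_combination h0
  constructor
  · refine sub_eq_zero.1 ((mul_eq_zero.1 ?_).resolve_right hD)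
    simp only [signedArea]
    linear_combination (B 1 - A 1) * e0 - (B 0 - A 0) * e1
  · refine sub_eq_zero.1 ((mul_eq_zero.1 ?_).resolve_right hD)
    simp only [signedArea]
    linear_combination (C 1 - B 1) * e0 - (C 0 - B 0) * e1

/-! ### Heron's formula and the hyperbolic cotangent -/

/-- Heron's formula. -/
theorem sqrt_heron (X Y Z : Plane) :
    √(((dist X Y + dist X Z) ^ 2 - dist Y Z ^ 2) * (dist Y Z ^ 2 - (dist X Y - dist X Z) ^ 2)) =
      2 * |signedArea X Y Z| := by
  have e : ((dist X Y + dist X Z) ^ 2 - dist Y Z ^ 2) *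
      (dist Y Z ^ 2 - (dist X Y - dist X Z) ^ 2) = (2 * |signedArea X Y Z|) ^ 2 := by
    have e' : ((dist X Y + dist X Z) ^ 2 - dist Y Z ^ 2) *
      (dist Y Z ^ 2 - (dist X Y - dist X Z) ^ 2) = 4 * (dist X Y ^ 2 * dist X Z ^ 2) -
        (dist X Y ^ 2 + dist X Z ^ 2 - dist Y Z ^ 2) ^ 2 := by ring
    rw [e', mul_pow, sq_abs, dist_sq, dist_sq, dist_sq]
    simp only [signedArea]
    ring
  rw [e, Real.sqrt_sq (by positivity)]

/-- The equation `log ((U + a) / (U - a)) = 2 * x` solved for `U`. -/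
theorem eq_mul_coth {a U : ℝ} (ha : 0 < a) (hU : a < U) :
    U = a * coth (Real.log ((U + a) / (U - a)) / 2) := by
  have hm : 0 < U - a := by linarith
  have hp : 0 < U + a := by linarith
  set x := Real.log ((U + a) / (U - a)) / 2 with hx
  have hE : Real.exp x * Real.exp x = (U + a) / (U - a) := by
    rw [← Real.exp_add, hx, add_halves, Real.exp_log (by positivity)]
  have hx0 : 0 < x := by
    have : 0 < Real.log ((U + a) / (U - a)) := Real.log_pos (by rw [lt_div_iff₀ hm]; linarith)
    positivity
  have hs : Real.sinh x ≠ 0 := (Real.sinh_pos_iff.2 hx0).ne'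
  rw [coth, ← mul_div_assoc, eq_div_iff hs, Real.sinh_eq, Real.cosh_eq]
  rw [eq_div_iff hm.ne'] at hE
  have h1 : Real.exp x * Real.exp (-x) = 1 := by rw [← Real.exp_add]; simp
  have h0 := (Real.exp_pos x).ne'
  refine mul_left_cancel₀ h0 ?_
  linear_combination hE / 2 - (U + a) / 2 * h1

/-! ### Points of zero field -/

/-- The consequences of a vanishing field, independently of the orientation of the triangle: a
clockwise triangle becomes counterclockwise when `B` and `C` are exchanged. -/
theorem field_eq_zero_consequences {A B C P : Plane} (hD : signedArea A B C ≠ 0)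
    (hP : P ∈ interior (triangle A B C)) (hE : field (triangle A B C) P = 0) :
    (signedArea P B C ≠ 0 ∧ signedArea P C A ≠ 0 ∧ signedArea P A B ≠ 0) ∧
    |signedArea P B C| + |signedArea P C A| + |signedArea P A B| = |signedArea A B C| ∧
    sidePotential B C P = sidePotential C A P ∧ sidePotential C A P = sidePotential A B P := by
  have main : ∀ A B C : Plane, 0 < signedArea A B C → P ∈ interior (triangle A B C) →
      field (triangle A B C) P = 0 →
      (signedArea P B C ≠ 0 ∧ signedArea P C A ≠ 0 ∧ signedArea P A B ≠ 0) ∧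
      |signedArea P B C| + |signedArea P C A| + |signedArea P A B| = |signedArea A B C| ∧
      sidePotential B C P = sidePotential C A P ∧ sidePotential C A P = sidePotential A B P := by
    intro A B C h hP hE
    have hP' := interior_triangle_subset h hP
    have hB : 0 < signedArea P C A := by rw [signedArea_rotate A]; exact hP'.2.1
    have hC : 0 < signedArea P A B := by rw [← signedArea_rotate P]; exact hP'.2.2
    refine ⟨⟨hP'.1.ne', hB.ne', hC.ne'⟩, ?_, sidePotential_eq_of_field_eq_zero h hP' hE⟩
    rw [abs_of_pos hP'.1, abs_of_pos hB, abs_of_pos hC, abs_of_pos h]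
    simp only [signedArea]; ring
  rcases lt_or_gt_of_ne hD with h | h
  · have hswap : triangle A C B = triangle A B C := by
      rw [triangle, triangle, Set.pair_comm C B]
    obtain ⟨⟨n1, n2, n3⟩, hsum, k1, k2⟩ := main A C B (by rw [signedArea_swap]; linarith)
      (by rwa [hswap]) (by rwa [hswap])
    rw [signedArea_swap, neg_ne_zero] at n1 n2 n3
    rw [signedArea_swap P B C, signedArea_swap P A B, signedArea_swap P C A,
      signedArea_swap A B C, abs_neg,
      abs_neg, abs_neg, abs_neg] at hsum
    rw [sidePotential_comm B C, sidePotential_comm A B] at k1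
    rw [sidePotential_comm A B, sidePotential_comm C A] at k2
    exact ⟨⟨n1, n3, n2⟩, by linarith, k1.trans k2, k2.symm⟩
  · exact main A B C h hP hE

end ElectrostaticTriangle

theorem theorem2 (A B C P : ElectrostaticTriangle.Plane)
    (hABC : AffineIndependent ℝ ![A, B, C])
    (hP : P ∈ interior (ElectrostaticTriangle.triangle A B C))
    (hE : ElectrostaticTriangle.field (ElectrostaticTriangle.triangle A B C) P = 0)
    (a b c s : ℝ)
    (ha : a = dist B C) (hb : b = dist C A) (hc : c = dist A B)
    (hs : s = (a + b + c) / 2) :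
    ∃ l u v w : ℝ, 0 < l ∧
      u = a * ElectrostaticTriangle.coth (a * l / (2 * s)) ∧
      v = b * ElectrostaticTriangle.coth (b * l / (2 * s)) ∧
      w = c * ElectrostaticTriangle.coth (c * l / (2 * s)) ∧
      √((u ^ 2 - a ^ 2) * (a ^ 2 - (v - w) ^ 2)) +
          √((v ^ 2 - b ^ 2) * (b ^ 2 - (w - u) ^ 2)) +
          √((w ^ 2 - c ^ 2) * (c ^ 2 - (u - v) ^ 2)) =
        √(2 * (a ^ 2 * b ^ 2 + b ^ 2 * c ^ 2 + c ^ 2 * a ^ 2) - (a ^ 4 + b ^ 4 + c ^ 4)) ∧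
      P 0 =
        ((A 0 ^ 2 + A 1 ^ 2 - v * w) * (B 1 - C 1) +
            (B 0 ^ 2 + B 1 ^ 2 - w * u) * (C 1 - A 1) +
            (C 0 ^ 2 + C 1 ^ 2 - u * v) * (A 1 - B 1)) /
          (2 * A 0 * (B 1 - C 1) + 2 * B 0 * (C 1 - A 1) + 2 * C 0 * (A 1 - B 1)) ∧
      P 1 =
        ((A 0 ^ 2 + A 1 ^ 2 - v * w) * (B 0 - C 0) +
            (B 0 ^ 2 + B 1 ^ 2 - w * u) * (C 0 - A 0) +
            (C 0 ^ 2 + C 1 ^ 2 - u * v) * (A 0 - B 0)) /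
          (2 * A 1 * (B 0 - C 0) + 2 * B 1 * (C 0 - A 0) + 2 * C 1 * (A 0 - B 0)) := by
  open ElectrostaticTriangle in
  have hD := signedArea_ne_zero_of_affineIndependent hABC
  obtain ⟨⟨nA, nB, nC⟩, hsum, hk₁, hk₂⟩ := field_eq_zero_consequences hD hP hE
  have ltA := dist_lt_add_of_signedArea_ne_zero nA
  have ltB := dist_lt_add_of_signedArea_ne_zero nB
  have ltC := dist_lt_add_of_signedArea_ne_zero nC
  have ha0 := (dist_pos_of_signedArea_ne_zero nA).2.2
  have hb0 := (dist_pos_of_signedArea_ne_zero nB).2.2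
  have hc0 := (dist_pos_of_signedArea_ne_zero nC).2.2
  have hA := dist_sq P A
  have hB := dist_sq P B
  have hC := dist_sq P C
  have heA := sqrt_heron P B C
  have heB := sqrt_heron P C A
  have heC := sqrt_heron P A B
  have heT := sqrt_heron A B C
  rw [dist_comm A C] at heT
  rw [← ha] at ltA ha0 heA heT
  rw [← hb] at ltB hb0 heB heT
  rw [← hc] at ltC hc0 heC heT
  have hs0 : 0 < s := by rw [hs]; positivity
  have hk0 : 0 < sidePotential B C P := by
    rw [sidePotential, ← ha]
    refine div_pos (Real.log_pos ?_) ha0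
    rw [lt_div_iff₀] <;> linarith
  have arg : ∀ {d k U : ℝ}, 0 < d → k = Real.log ((U + d) / (U - d)) / d →
      sidePotential B C P = k →
      d * (s * sidePotential B C P) / (2 * s) = Real.log ((U + d) / (U - d)) / 2 := by
    intro d k U hd h1 h2
    rw [h2, h1]
    field_simp
  refine ⟨s * sidePotential B C P, dist P B + dist P C, dist P C + dist P A, dist P A + dist P B,
    by positivity, ?_, ?_, ?_, ?_, ?_, ?_⟩
  · rw [arg ha0 (by rw [sidePotential, ha]) rfl]
    exact eq_mul_coth ha0 ltA
  · rw [arg hb0 (by rw [sidePotential, hb]) hk₁]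
    exact eq_mul_coth hb0 ltB
  · rw [arg hc0 (by rw [sidePotential, hc]) (hk₁.trans hk₂)]
    exact eq_mul_coth hc0 ltC
  · rw [show dist P C + dist P A - (dist P A + dist P B) = -(dist P B - dist P C) by ring,
      show dist P A + dist P B - (dist P B + dist P C) = -(dist P C - dist P A) by ring,
      show dist P B + dist P C - (dist P C + dist P A) = -(dist P A - dist P B) by ring,
      neg_sq, neg_sq, neg_sq, heA, heB, heC, ← mul_add, ← mul_add, hsum, ← heT]
    congr 1
    ring
  · simp only [signedArea] at hD
    rw [eq_div_iff (by
      intro h0; apply hD; linear_combination h0 / 2)]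
    linear_combination (B 1 - C 1) * hA + (C 1 - A 1) * hB + (A 1 - B 1) * hC
  · simp only [signedArea] at hD
    rw [eq_div_iff (by
      intro h0; apply hD; linear_combination -h0 / 2)]
    linear_combination (B 0 - C 0) * hA + (C 0 - A 0) * hB + (A 0 - B 0) * hC
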